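/- Let $q$ be a prime power and $n\ge 1$, let $K=\mathbb{F}_{q^n}$, and let $\sigma$ be an automorphism of $K$ whose fixed field is $\mathbb{F}_q$. Let $R=K[t;\sigma]$ be the skew polynomial ring: its elements are the polynomials $\sum_i a_it^i$ with $a_i\in K$, with termwise addition and multiplication determined by $ta=\sigma(a)t$ for $a\in K$. An element $f\in R$ of degree $d\ge 1$ is called irreducible if it is not a product $ab$ of elements $a,b\in R$ of degree less than $d$. For such an $f$, let $\mathbb{S}_f$ be the set of elements of $R$ of degree less than $d$, with the addition of $R$ and the multiplication $a\circ_f b$ defined as the remainder of $ab$ on right division by $f$ (the unique $r\in R$ of degree less than $d$ with $ab-r\in Rf$). The minimal central left multiple $\mathrm{mzlm}(f)$ is the monic element of least degree of the centre of $R$ that lies in $Rf$; it is of the form $\hat f(t^n)$ with $\hat f\in\mathbb{F}_q[y]$. Let $f,g\in R$ be irreducible of the same degree $d$, with $\mathrm{mzlm}(f)=\hat f(t^n)$ and $\mathrm{mzlm}(g)=\hat g(t^n)$, where $\hat f,\hat g\in\mathbb{F}_q[y]$. Suppose that $$\hat g(y)=\lambda^{-d}\hat f^{\rho}(\lambda y)$$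 for some $\lambda\in\mathbb{F}_q^\times$ and some $\rho\in\mathrm{Aut}(\mathbb{F}_q)$, where $\hat f^\rho$ is obtained from $\hat f$ by applying $\rho$ to its coefficients. Then $\mathbb{S}_f$ and $\mathbb{S}_g$ are isotopic: there are additive bijections $A,B,C\colon\mathbb{S}_f\to\mathbb{S}_g$ such that $A(x)\circ_g B(y)=C(x\circ_f y)$ for all $x,y\in\mathbb{S}_f$. -/

import Mathlib

namespace SkewSemifield

/- The skew polynomial ring `K[t; σ]` is Mathlib's `SkewPolynomial K`; the automorphism `σ` is
encoded by the action of `Multiplicative ℕ` on `K` (the generator acts as `σ`), so that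
`t * a = σ(a) * t`, where `t = SkewPolynomial.X`. -/

/-- The subfield of elements of `K` fixed by the automorphism `σ`. -/
abbrev fixedField {K : Type*} [Field K] (σ : K ≃+* K) : Subfield K :=
  RingHom.eqLocusField (σ : K →+* K) (RingHom.id K)

section Degree

variable {K : Type*} [Field K]

/-- The degree of a skew polynomial, with `degree 0 = ⊥`. -/
def degree (p : SkewPolynomial K) : WithBot ℕ := p.support.max

/-- The degree of a skew polynomial as a natural number, with the value `0` at `p = 0`. -/
def natDegree (p : SkewPolynomial K) : ℕ := (degree p).unbotD 0

/-- The leading coefficient is `1`. -/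
def IsMonic (p : SkewPolynomial K) : Prop := p.coeff (natDegree p) = 1

theorem degree_lt_iff (p : SkewPolynomial K) (d : ℕ) :
    degree p < d ↔ ∀ i, d ≤ i → p.coeff i = 0 := by
  rw [degree, Finset.max_eq_sup_withBot]
  refine (Finset.sup_lt_iff (WithBot.bot_lt_coe d)).trans ?_
  constructor
  · intro h i hi
    by_contra hc
    have := h i (SkewPolynomial.mem_support_iff.mpr hc)
    exact absurd (WithBot.coe_lt_coe.mp this) (not_lt.mpr hi)
  · intro h i hi
    refine WithBot.coe_lt_coe.mpr (lt_of_not_ge fun hle => ?_)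
    exact SkewPolynomial.mem_support_iff.mp hi (h i hle)

theorem coeff_natDegree_ne_zero {f : SkewPolynomial K} (hf : f ≠ 0) :
    f.coeff (natDegree f) ≠ 0 := by
  have hne : f.support.Nonempty := by
    rw [Finset.nonempty_iff_ne_empty]
    exact fun h => hf (SkewPolynomial.support_eq_empty.mp h)
  obtain ⟨m, hm⟩ := Finset.max_of_nonempty hne
  have h1 : natDegree f = m := by
    rw [natDegree, degree, hm]; rfl
  rw [h1]
  exact SkewPolynomial.mem_support_iff.mp (Finset.mem_of_max hm)

theorem coeff_eq_zero_of_natDegree_lt {f : SkewPolynomial K} {i : ℕ} (hi : natDegree f < i) :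
    f.coeff i = 0 := by
  by_contra hc
  have h1 : (i : WithBot ℕ) ≤ degree f :=
    Finset.le_max (SkewPolynomial.mem_support_iff.mpr hc)
  rw [natDegree] at hi
  cases hd : degree f with
  | bot => rw [hd] at h1; simp at h1
  | coe m =>
    rw [hd] at h1 hi
    have h2 : i ≤ m := WithBot.coe_le_coe.mp h1
    have h3 : m < i := hi
    omega

/-- The additive group of skew polynomials of degree strictly less than `d`. -/
def degreeLT (K : Type*) [Field K] [MulSemiringAction (Multiplicative ℕ) K] (d : ℕ) :
    AddSubgroup (SkewPolynomial K) where
  carrier := {a | degree a < d}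
  zero_mem' := by
    rw [Set.mem_ofPred_eq, degree_lt_iff]
    intro i _
    exact SkewPolynomial.coeff_zero i
  add_mem' := by
    intro a b ha hb
    rw [Set.mem_ofPred_eq, degree_lt_iff] at *
    intro i hi
    rw [SkewPolynomial.coeff_add, ha i hi, hb i hi, add_zero]
  neg_mem' := by
    intro a ha
    rw [Set.mem_ofPred_eq, degree_lt_iff] at *
    intro i hi
    rw [SkewPolynomial.coeff_neg, ha i hi, neg_zero]

end Degree

section Semifield

variable {K : Type*} [Field K] [MulSemiringAction (Multiplicative ℕ) K]

/-- `f` is irreducible: it has positive degree and is not a product of two skew polynomials of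
smaller degree. -/
def IsIrred (f : SkewPolynomial K) : Prop :=
  0 < degree f ∧ ¬ ∃ a b : SkewPolynomial K, degree a < degree f ∧ degree b < degree f ∧ f = a * b

/-- `f` divides `h` on the right. -/
def RightDvd (f h : SkewPolynomial K) : Prop := ∃ u : SkewPolynomial K, h = u * f

theorem coeff_monomial_mul_add (n : ℕ) (c : K) (f : SkewPolynomial K) (j : ℕ) :
    (SkewPolynomial.monomial n c * f).coeff (n + j) =
      c * SkewPolynomial.φ^[n] (f.coeff j) := by
  induction f using SkewPolynomial.induction with
  | h0 => simp
  | ha m r q _ _ ih =>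
    rw [mul_add, SkewPolynomial.coeff_add, ih, SkewPolynomial.monomial_mul_monomial,
      SkewPolynomial.coeff_add, SkewPolynomial.coeff_monomial, SkewPolynomial.coeff_monomial,
      iterate_map_add, mul_add]
    by_cases h : m = j
    · simp [h]
    · simp [h]

theorem coeff_mul_top (f : SkewPolynomial K) (u : SkewPolynomial K) (m : ℕ)
    (hu : ∀ i, m < i → u.coeff i = 0) :
    ∀ k, m + natDegree f ≤ k →
      (u * f).coeff k =
        if k = m + natDegree f then
          u.coeff m * SkewPolynomial.φ^[m] (f.coeff (natDegree f)) else 0 := by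
  intro k hk
  have h1 : u * f = ∑ i ∈ u.support, SkewPolynomial.monomial i (u.coeff i) * f := by
    rw [← Finset.sum_mul]
    congr 1
    conv_lhs => rw [← SkewPolynomial.sum_monomial u, SkewPolynomial.sum_def]
  let co : SkewPolynomial K →+ K :=
    { toFun := fun p => p.coeff k
      map_zero' := SkewPolynomial.coeff_zero k
      map_add' := fun p q => SkewPolynomial.coeff_add p q k }
  have h2 : (u * f).coeff k =
      ∑ i ∈ u.support, (SkewPolynomial.monomial i (u.coeff i) * f).coeff k := by
    rw [h1]; exact map_sum co _ _
  have h3 : ∀ i ∈ u.support, (SkewPolynomial.monomial i (u.coeff i) * f).coeff k =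
      if i = m then (if k = m + natDegree f then
          u.coeff m * SkewPolynomial.φ^[m] (f.coeff (natDegree f)) else 0) else 0 := by
    intro i hi
    have him : i ≤ m := by
      by_contra hc
      exact SkewPolynomial.mem_support_iff.mp hi (hu i (by omega))
    obtain ⟨j, rfl⟩ : ∃ j, k = i + j := ⟨k - i, by omega⟩
    rw [coeff_monomial_mul_add]
    by_cases hj : natDegree f < j
    · rw [coeff_eq_zero_of_natDegree_lt hj, iterate_map_zero, mul_zero]
      split_ifs with h4 h5
      · omega
      · rfl
      · rfl
    · have h4 : i = m := by omega
      have h5 : j = natDegree f := by omega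
      subst h4 h5
      simp
  rw [h2, Finset.sum_congr rfl h3, Finset.sum_ite_eq']
  by_cases hm : m ∈ u.support
  · rw [if_pos hm]
  · rw [if_neg hm]
    have : u.coeff m = 0 := by
      by_contra hc
      exact hm (SkewPolynomial.mem_support_iff.mpr hc)
    simp [this]

theorem exists_remainder {f : SkewPolynomial K} (hf : f ≠ 0) (a : SkewPolynomial K) :
    ∃ r u : SkewPolynomial K, degree r < natDegree f ∧ a = u * f + r := by
  have key : ∀ (n : ℕ) (a : SkewPolynomial K), (∀ i, n ≤ i → a.coeff i = 0) →
      ∃ r u : SkewPolynomial K, degree r < natDegree f ∧ a = u * f + r := by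
    intro n
    induction n with
    | zero =>
      intro a ha
      refine ⟨a, 0, ?_, by simp⟩
      rw [degree_lt_iff]
      exact fun i _ => ha i (Nat.zero_le i)
    | succ n ih =>
      intro a ha
      by_cases hn : n < natDegree f
      · refine ⟨a, 0, ?_, by simp⟩
        rw [degree_lt_iff]
        exact fun i hi => ha i (by omega)
      · obtain ⟨e, he⟩ : ∃ e, n = e + natDegree f := ⟨n - natDegree f, by omega⟩
        have hlead : SkewPolynomial.φ^[e] (f.coeff (natDegree f)) ≠ 0 := by
          rw [SkewPolynomial.φ_iterate_apply]
          exact (map_ne_zero (MulSemiringAction.toRingHom (Multiplicative ℕ) K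
            (Multiplicative.ofAdd e))).mpr (coeff_natDegree_ne_zero hf)
        set m : SkewPolynomial K := SkewPolynomial.monomial e
          (a.coeff n / SkewPolynomial.φ^[e] (f.coeff (natDegree f))) with hm
        have hm0 : ∀ i, e < i → m.coeff i = 0 := by
          intro i hi
          rw [hm, SkewPolynomial.coeff_monomial, if_neg (by omega)]
        obtain ⟨r, u, hr, hu⟩ := ih (a - m * f) (by
          intro i hi
          rw [SkewPolynomial.coeff_sub, coeff_mul_top f m e hm0 i (by omega)]
          by_cases hin : i = n
          · rw [if_pos (by omega), hm, SkewPolynomial.coeff_monomial, if_pos rfl,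
              div_mul_cancel₀ _ hlead, hin, sub_self]
          · rw [if_neg (by omega), ha i (by omega), sub_zero])
        refine ⟨r, u + m, hr, ?_⟩
        rw [add_mul, add_right_comm, ← hu, sub_add_cancel]
  refine key (natDegree a + 1) a fun i hi => coeff_eq_zero_of_natDegree_lt (by omega)

theorem remainder_unique {f : SkewPolynomial K} (hf : f ≠ 0) {r s u v : SkewPolynomial K}
    (hr : degree r < natDegree f) (hs : degree s < natDegree f)
    (h : u * f + r = v * f + s) : r = s := by
  have h1 : (u - v) * f = s - r := by
    rw [sub_mul, sub_eq_sub_iff_add_eq_add, h, add_comm]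
  suffices h2 : u - v = 0 by
    rw [h2, zero_mul] at h1
    exact (sub_eq_zero.mp h1.symm).symm
  by_contra hw
  have h3 := coeff_mul_top f (u - v) (natDegree (u - v))
    (fun i hi => coeff_eq_zero_of_natDegree_lt hi) _ le_rfl
  rw [if_pos rfl, h1, SkewPolynomial.coeff_sub,
    (degree_lt_iff r _).mp hr _ (Nat.le_add_left _ _),
    (degree_lt_iff s _).mp hs _ (Nat.le_add_left _ _), sub_self,
    SkewPolynomial.φ_iterate_apply] at h3
  rcases mul_eq_zero.mp h3.symm with h4 | h4
  · exact coeff_natDegree_ne_zero hw h4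
  · exact (map_ne_zero (MulSemiringAction.toRingHom (Multiplicative ℕ) K
      (Multiplicative.ofAdd (natDegree (u - v))))).mpr (coeff_natDegree_ne_zero hf) h4

open Classical in
/-- The remainder of `a` on right division by `f`, that is, the unique `r` of degree less than
that of `f` with `a = u * f + r` for some `u` (and `0` in the irrelevant case `f = 0`). -/
noncomputable def modRight (f a : SkewPolynomial K) : SkewPolynomial K :=
  if hf : f = 0 then 0 else (exists_remainder hf a).choose

theorem modRight_zero_left (a : SkewPolynomial K) : modRight 0 a = 0 := by
  rw [modRight, dif_pos rfl]

theorem degree_modRight_lt (f a : SkewPolynomial K) : degree (modRight f a) < natDegree f := by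
  by_cases hf : f = 0
  · subst hf
    rw [modRight_zero_left, degree_lt_iff]
    exact fun i _ => SkewPolynomial.coeff_zero i
  · rw [modRight, dif_neg hf]
    exact (exists_remainder hf a).choose_spec.choose_spec.1

theorem exists_eq_mul_add_modRight {f : SkewPolynomial K} (hf : f ≠ 0) (a : SkewPolynomial K) :
    ∃ u : SkewPolynomial K, a = u * f + modRight f a := by
  rw [modRight, dif_neg hf]
  exact ⟨_, (exists_remainder hf a).choose_spec.choose_spec.2⟩

theorem modRight_eq {f : SkewPolynomial K} (hf : f ≠ 0) {a u r : SkewPolynomial K}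
    (hr : degree r < natDegree f) (h : a = u * f + r) : modRight f a = r := by
  obtain ⟨v, hv⟩ := exists_eq_mul_add_modRight hf a
  exact remainder_unique hf (degree_modRight_lt f a) hr (hv.symm.trans h)

theorem modRight_add (f a b : SkewPolynomial K) :
    modRight f (a + b) = modRight f a + modRight f b := by
  by_cases hf : f = 0
  · subst hf
    simp only [modRight_zero_left, add_zero]
  · obtain ⟨u, hu⟩ := exists_eq_mul_add_modRight hf a
    obtain ⟨v, hv⟩ := exists_eq_mul_add_modRight hf b
    refine modRight_eq (u := u + v) hf
      ((degreeLT K (natDegree f)).add_mem (degree_modRight_lt f a) (degree_modRight_lt f b)) ?_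
    conv_lhs => rw [hu, hv]
    rw [add_mul]
    abel

theorem modRight_zero (f : SkewPolynomial K) : modRight f 0 = 0 := by
  have h := modRight_add f 0 0
  rw [add_zero] at h
  exact left_eq_add.mp h

/-- The algebra `𝕊_f`: the skew polynomials of degree less than that of `f`, with the
multiplication `a ∘ b = a * b mod f` (remainder on right division by `f`). -/
def SemifieldOf (f : SkewPolynomial K) : Type _ := degreeLT K (natDegree f)

noncomputable instance (f : SkewPolynomial K) : AddCommGroup (SemifieldOf f) :=
  inferInstanceAs (AddCommGroup (degreeLT K (natDegree f)))

/-- The underlying skew polynomial of an element of `𝕊_f`. -/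
def SemifieldOf.val {f : SkewPolynomial K} (a : SemifieldOf f) : SkewPolynomial K := Subtype.val a

noncomputable instance (f : SkewPolynomial K) : NonUnitalNonAssocRing (SemifieldOf f) where
  mul a b := ⟨modRight f (a.val * b.val), degree_modRight_lt f _⟩
  left_distrib a b c := Subtype.ext <| by
    change modRight f (a.val * (b.val + c.val)) =
      modRight f (a.val * b.val) + modRight f (a.val * c.val)
    rw [mul_add, modRight_add]
  right_distrib a b c := Subtype.ext <| by
    change modRight f ((a.val + b.val) * c.val) =
      modRight f (a.val * c.val) + modRight f (b.val * c.val)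
    rw [add_mul, modRight_add]
  zero_mul a := Subtype.ext <| by
    change modRight f (0 * a.val) = 0
    rw [zero_mul, modRight_zero]
  mul_zero a := Subtype.ext <| by
    change modRight f (a.val * 0) = 0
    rw [mul_zero, modRight_zero]

/-- `h` is the minimal central left multiple of `f`: the monic element of least degree of the
centre of the skew polynomial ring that is right-divisible by `f`. -/
def IsMinCentralLeftMultiple (f h : SkewPolynomial K) : Prop :=
  (h ∈ Subring.center (SkewPolynomial K) ∧ IsMonic h ∧ RightDvd f h) ∧
  ∀ h' : SkewPolynomial K,
    h' ∈ Subring.center (SkewPolynomial K) → IsMonic h' → RightDvd f h' → degree h ≤ degree h'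

/-- The skew polynomial `p(t ^ n)`, for an ordinary polynomial `p` over the fixed field of `σ`. -/
noncomputable def evalXPow (σ : K ≃+* K) (n : ℕ) (p : Polynomial (fixedField σ)) :
    SkewPolynomial K :=
  p.eval₂ (SkewPolynomial.CRingHom.comp (fixedField σ).subtype) (SkewPolynomial.X ^ n)

end Semifield

/-- The polynomial `μ^{-d} p^ρ(μ y)`, where `p^ρ` is `p` with `ρ` applied to its coefficients. -/
noncomputable def twist {F : Type*} [Field F] (d : ℕ) (μ : Fˣ) (ρ : F ≃+* F) (p : Polynomial F) :
    Polynomial F :=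
  Polynomial.C ((μ : F)⁻¹ ^ d) *
    (p.map (ρ : F →+* F)).comp (Polynomial.C (μ : F) * Polynomial.X)

/-- Two (not necessarily associative) rings are isotopic if there are additive bijections
`A`, `B`, `C` between them with `A x * B y = C (x * y)`. (For finite semifields, additive maps are
the same as linear maps over the prime field.) -/
def Isotopic (S T : Type*) [NonUnitalNonAssocRing S] [NonUnitalNonAssocRing T] : Prop :=
  ∃ A B C : S ≃+ T, ∀ x y : S, A x * B y = C (x * y)

end SkewSemifield

namespace SkewSemifield

open SkewPolynomial

/-! ### Degree bookkeeping. -/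

section Basic

variable {K : Type*} [Field K]

/-! Write `R = K[t; σ]`. The isotopism is a composite of two.

First, an automorphism of `R` moves `f` to a polynomial with the same minimal central left multiple
as `g`. The norm from `K` to the fixed field is surjective, so there is `c` with `c σ(c) ⋯
σ^(n-1)(c)` equal to the given scalar `μ`; and `ρ`, being a power of Frobenius, extends to an
automorphism `τ` of `K` commuting with `σ`. The substitution `a t^i ↦ τ(a) (c t)^i` sends `t^n` to
`μ t^n`, hence `f̂(t^n)` to `ĝ(t^n)` up to the factor `μ^d` (`evalXPow_twist`). It preserves
degrees, so it induces an isomorphism of the algebras (`isotopic_map`) and transports minimal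
central left multiples.

Second, irreducibles `f`, `g` of the same degree with the same minimal central left multiple `h`
give isotopic algebras (`IsIrred.isotopic_of_isMinCentralLeftMultiple`). The point is to find `u ∉
Rf` with `g u ∈ Rf`. Otherwise left multiplication by `g` is injective, so bijective, on the finite
module `R/Rf`; writing `h = a g`, which kills `R/Rf`, one sees that `a` kills it too. But when `t ∉
Rf`, a least-degree annihilator of `R/Rf` is central up to a scalar
(`IsIrred.exists_central_of_annihilates`), so `a` has degree at least that of `h`: a contradiction.
Given `u`, right multiplication by `u` is an isomorphism `T : R/Rg → R/Rf` of left modules, and `x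
(y u) = (x y) u` says that `(id, T, T)` is an isotopism. -/

theorem degree_eq_natDegree {p : SkewPolynomial K} (hp : p ≠ 0) : degree p = natDegree p := by
  rw [natDegree]
  cases hd : degree p with
  | bot =>
    rw [degree, Finset.max_eq_bot, support_eq_empty] at hd
    exact absurd hd hp
  | coe m => rfl

theorem degree_zero : degree (0 : SkewPolynomial K) = ⊥ := by
  rw [degree, support_zero, Finset.max_empty]

theorem natDegree_lt_of_degree_lt {p : SkewPolynomial K} (hp : p ≠ 0) {d : ℕ}
    (h : degree p < d) : natDegree p < d := by
  rw [degree_eq_natDegree hp] at h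
  exact WithBot.coe_lt_coe.mp h

theorem degree_lt_of_natDegree_lt {p : SkewPolynomial K} {d : ℕ} (h : natDegree p < d) :
    degree p < d :=
  (degree_lt_iff p d).mpr fun _ hi => coeff_eq_zero_of_natDegree_lt (h.trans_le hi)

theorem le_natDegree_of_coeff_ne_zero {p : SkewPolynomial K} {i : ℕ} (h : p.coeff i ≠ 0) :
    i ≤ natDegree p := by
  by_contra hc
  exact h (coeff_eq_zero_of_natDegree_lt (not_le.mp hc))

theorem natDegree_eq_of_degree_eq {p : SkewPolynomial K} {d : ℕ} (h : degree p = d) :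
    natDegree p = d := by
  rw [natDegree, h]; rfl

theorem eq_C_of_natDegree_eq_zero {p : SkewPolynomial K} (h : natDegree p = 0) :
    p = C (p.coeff 0) := by
  ext i
  rcases Nat.eq_zero_or_pos i with rfl | hi
  · rw [coeff_C_zero]
  · rw [coeff_C_ne_zero hi.ne', coeff_eq_zero_of_natDegree_lt (h ▸ hi)]

theorem degree_congr {p q : SkewPolynomial K} (h : ∀ i, p.coeff i = 0 ↔ q.coeff i = 0) :
    degree p = degree q := by
  rw [degree, degree]
  congr 1
  ext i
  rw [mem_support_iff, mem_support_iff, Ne, Ne, h]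

end Basic

/-! ### Arithmetic of the skew polynomial ring, its left ideals and irreducible elements. -/

section Ring

variable {K : Type*} [Field K] [MulSemiringAction (Multiplicative ℕ) K]

theorem iterate_φ_ne_zero {c : K} (hc : c ≠ 0) (n : ℕ) : φ^[n] c ≠ 0 := by
  rw [φ_iterate_apply]
  exact (map_ne_zero (MulSemiringAction.toRingHom (Multiplicative ℕ) K
    (Multiplicative.ofAdd n))).mpr hc

theorem coeff_mul_natDegree_add (u f : SkewPolynomial K) :
    (u * f).coeff (natDegree u + natDegree f) =
      u.coeff (natDegree u) * φ^[natDegree u] (f.coeff (natDegree f)) := by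
  rw [coeff_mul_top f u (natDegree u) (fun i hi => coeff_eq_zero_of_natDegree_lt hi) _ le_rfl,
    if_pos rfl]

theorem coeff_mul_natDegree_add_ne_zero {u f : SkewPolynomial K} (hu : u ≠ 0) (hf : f ≠ 0) :
    (u * f).coeff (natDegree u + natDegree f) ≠ 0 := by
  rw [coeff_mul_natDegree_add]
  exact mul_ne_zero (coeff_natDegree_ne_zero hu) (iterate_φ_ne_zero (coeff_natDegree_ne_zero hf) _)

theorem mul_ne_zero_of_ne_zero {u f : SkewPolynomial K} (hu : u ≠ 0) (hf : f ≠ 0) :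
    u * f ≠ 0 := fun h =>
  coeff_mul_natDegree_add_ne_zero hu hf (by rw [h, coeff_zero])

theorem natDegree_mul {u f : SkewPolynomial K} (hu : u ≠ 0) (hf : f ≠ 0) :
    natDegree (u * f) = natDegree u + natDegree f := by
  refine le_antisymm ?_ (le_natDegree_of_coeff_ne_zero (coeff_mul_natDegree_add_ne_zero hu hf))
  by_contra hc
  refine coeff_natDegree_ne_zero (mul_ne_zero_of_ne_zero hu hf) ?_
  rw [coeff_mul_top f u (natDegree u) (fun i hi => coeff_eq_zero_of_natDegree_lt hi) _
    (not_le.mp hc).le, if_neg (by omega)]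

theorem C_inv_mul_C {c : K} (hc : c ≠ 0) : (C c⁻¹ * C c : SkewPolynomial K) = 1 := by
  rw [← C_mul, inv_mul_cancel₀ hc, C_1]

theorem coeff_C_mul (c : K) (p : SkewPolynomial K) (i : ℕ) :
    (C c * p).coeff i = c * p.coeff i := by
  have h := coeff_monomial_mul_add 0 c p i
  rwa [monomial_zero_left, zero_add, Function.iterate_zero, id] at h

theorem degree_C_mul {c : K} (hc : c ≠ 0) (p : SkewPolynomial K) : degree (C c * p) = degree p :=
  degree_congr fun i => by rw [coeff_C_mul, mul_eq_zero, or_iff_right hc]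

theorem natDegree_C_mul {c : K} (hc : c ≠ 0) (p : SkewPolynomial K) :
    natDegree (C c * p) = natDegree p := by
  rw [natDegree, natDegree, degree_C_mul hc]

theorem coeff_X_mul_succ (p : SkewPolynomial K) (i : ℕ) :
    (X * p).coeff (i + 1) = φ (p.coeff i) := by
  have h := coeff_monomial_mul_add 1 1 p i
  rwa [monomial_one_one_eq_X, one_mul, add_comm] at h

theorem coeff_X_mul_zero (p : SkewPolynomial K) : (X * p).coeff 0 = 0 := by
  induction p using SkewPolynomial.induction with
  | h0 => rw [mul_zero, coeff_zero]
  | ha m r q _ _ ih => rw [mul_add, coeff_add, ih, X_mul_monomial, coeff_monomial_succ, add_zero]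

theorem coeff_mul_C (p : SkewPolynomial K) (c : K) (i : ℕ) :
    (p * C c).coeff i = p.coeff i * φ^[i] c := by
  induction p using SkewPolynomial.induction with
  | h0 => rw [zero_mul, coeff_zero, zero_mul]
  | ha m r q _ _ ih =>
    rw [add_mul, coeff_add, ih, monomial_mul_C, coeff_add, coeff_monomial, coeff_monomial, add_mul]
    split_ifs with h
    · rw [h]
    · rw [zero_mul]

theorem coeff_mul_X_succ (p : SkewPolynomial K) (i : ℕ) :
    (p * X).coeff (i + 1) = p.coeff i := by
  induction p using SkewPolynomial.induction with
  | h0 => rw [zero_mul, coeff_zero, coeff_zero]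
  | ha m r q _ _ ih =>
    rw [add_mul, coeff_add, ih, monomial_mul_X, coeff_add, coeff_monomial, coeff_monomial]
    simp only [Nat.add_right_cancel_iff]

theorem coeff_mul_X_zero (p : SkewPolynomial K) : (p * X).coeff 0 = 0 := by
  induction p using SkewPolynomial.induction with
  | h0 => rw [zero_mul, coeff_zero]
  | ha m r q _ _ ih => rw [add_mul, coeff_add, ih, monomial_mul_X, coeff_monomial_succ, add_zero]

theorem mem_center_of_commute {z : SkewPolynomial K} (hX : X * z = z * X)
    (hC : ∀ c : K, C c * z = z * C c) : z ∈ Subring.center (SkewPolynomial K) := by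
  rw [Subring.mem_center_iff]
  intro p
  induction p using SkewPolynomial.induction with
  | h0 => rw [zero_mul, mul_zero]
  | ha m r q _ _ ih =>
    rw [add_mul, mul_add, ih, ← C_mul_X_pow_eq_monomial]
    congr 1
    exact ((show Commute (C r) z from hC r).mul_left ((show Commute X z from hX).pow_left m)).eq

theorem rightDvd_iff_mem_span {f h : SkewPolynomial K} : RightDvd f h ↔ h ∈ Ideal.span {f} := by
  rw [Ideal.mem_span_singleton']
  exact ⟨fun ⟨u, hu⟩ => ⟨u, hu.symm⟩, fun ⟨u, hu⟩ => ⟨u, hu.symm⟩⟩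

theorem modRight_eq_zero_iff {f : SkewPolynomial K} (hf : f ≠ 0) (a : SkewPolynomial K) :
    modRight f a = 0 ↔ a ∈ Ideal.span {f} := by
  constructor
  · intro h
    obtain ⟨u, hu⟩ := exists_eq_mul_add_modRight hf a
    rw [h, add_zero] at hu
    exact Ideal.mem_span_singleton'.mpr ⟨u, hu.symm⟩
  · intro h
    obtain ⟨u, hu⟩ := Ideal.mem_span_singleton'.mp h
    refine modRight_eq hf (u := u) ?_ (by rw [hu, add_zero])
    rw [degree_zero]
    exact WithBot.bot_lt_coe _

theorem modRight_sub (f a b : SkewPolynomial K) :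
    modRight f (a - b) = modRight f a - modRight f b := by
  rw [eq_sub_iff_add_eq, ← modRight_add, sub_add_cancel]

theorem modRight_of_degree_lt {f : SkewPolynomial K} (hf : f ≠ 0) {a : SkewPolynomial K}
    (ha : degree a < natDegree f) : modRight f a = a :=
  modRight_eq hf (u := 0) ha (by rw [zero_mul, zero_add])

theorem sub_modRight_mem_span {f : SkewPolynomial K} (hf : f ≠ 0) (a : SkewPolynomial K) :
    a - modRight f a ∈ Ideal.span {f} := by
  obtain ⟨u, hu⟩ := exists_eq_mul_add_modRight hf a
  exact Ideal.mem_span_singleton'.mpr ⟨u, eq_sub_of_add_eq hu.symm⟩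

theorem modRight_eq_modRight_iff {f : SkewPolynomial K} (hf : f ≠ 0) {a b : SkewPolynomial K} :
    modRight f a = modRight f b ↔ a - b ∈ Ideal.span {f} := by
  rw [← modRight_eq_zero_iff hf, modRight_sub, sub_eq_zero]

/-- Right division by a nonzero element of least degree leaves remainder zero. Here `Ideal` means
left ideal. -/
theorem exists_eq_span_singleton (L : Ideal (SkewPolynomial K)) :
    ∃ p, L = Ideal.span {p} := by
  classical
  by_cases hL : ∃ m, ∃ p ∈ L, p ≠ 0 ∧ natDegree p = m
  · obtain ⟨p, hpL, hp, hm⟩ := Nat.find_spec hL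
    refine ⟨p, le_antisymm (fun a ha => ?_) ((Ideal.span_singleton_le_iff_mem L).mpr hpL)⟩
    rw [← modRight_eq_zero_iff hp]
    by_contra hr
    have hrL : modRight p a ∈ L := by
      have h := L.sub_mem ha
        ((Ideal.span_singleton_le_iff_mem L).mpr hpL (sub_modRight_mem_span hp a))
      rwa [sub_sub_cancel] at h
    have hlt := natDegree_lt_of_degree_lt hr (degree_modRight_lt p a)
    exact Nat.find_min hL (hm ▸ hlt) ⟨_, hrL, hr, rfl⟩
  · refine ⟨0, ?_⟩
    rw [Ideal.span_singleton_eq_bot.mpr rfl, eq_bot_iff]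
    intro a ha
    by_contra h
    exact hL ⟨_, a, ha, h, rfl⟩

theorem IsIrred.ne_zero {f : SkewPolynomial K} (hf : IsIrred f) : f ≠ 0 := by
  rintro rfl
  have := hf.1
  rw [degree_zero] at this
  exact not_lt_bot this

theorem IsIrred.natDegree_pos {f : SkewPolynomial K} (hf : IsIrred f) : 0 < natDegree f := by
  have := hf.1
  rw [degree_eq_natDegree hf.ne_zero] at this
  exact WithBot.coe_lt_coe.mp this

theorem IsIrred.natDegree_eq_zero_or {f : SkewPolynomial K} (hf : IsIrred f)
    {a b : SkewPolynomial K} (h : f = a * b) : natDegree a = 0 ∨ natDegree b = 0 := by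
  have hab : a * b ≠ 0 := h ▸ hf.ne_zero
  have hd : natDegree f = natDegree a + natDegree b := by
    rw [h, natDegree_mul (left_ne_zero_of_mul hab) (right_ne_zero_of_mul hab)]
  by_contra! hc
  refine hf.2 ⟨a, b, ?_, ?_, h⟩ <;> rw [degree_eq_natDegree hf.ne_zero] <;>
    exact degree_lt_of_natDegree_lt (by omega)

/-- Left ideals are principal, so one above `Rf` is some `Rp` with `f = w p`. By irreducibility `w`
or `p` is a nonzero constant, hence a unit: `Rp` is `Rf` or everything. -/
theorem IsIrred.isMaximal_span {f : SkewPolynomial K} (hf : IsIrred f) :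
    (Ideal.span {f}).IsMaximal := by
  refine ⟨?_, fun L hL => ?_⟩
  · intro h
    obtain ⟨u, hu⟩ := Ideal.mem_span_singleton'.mp ((Ideal.eq_top_iff_one _).mp h)
    have huf : u * f ≠ 0 := by rw [hu]; exact one_ne_zero
    have h1 := le_natDegree_of_coeff_ne_zero
      (coeff_mul_natDegree_add_ne_zero (left_ne_zero_of_mul huf) hf.ne_zero)
    have h2 : natDegree (u * f) = 0 := by
      by_contra hc
      refine coeff_natDegree_ne_zero huf ?_
      rw [hu, ← C_1, coeff_C_ne_zero]
      rwa [hu] at hc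
    have := hf.natDegree_pos
    omega
  · obtain ⟨p, rfl⟩ := exists_eq_span_singleton L
    obtain ⟨w, hw⟩ := Ideal.mem_span_singleton'.mp
      (hL.le (Ideal.mem_span_singleton_self f))
    have hwp : w * p ≠ 0 := hw ▸ hf.ne_zero
    rcases hf.natDegree_eq_zero_or hw.symm with h | h
    · refine absurd ((Ideal.span_singleton_le_iff_mem _).mpr ?_) hL.not_ge
      have hc : w.coeff 0 ≠ 0 := h ▸ coeff_natDegree_ne_zero (left_ne_zero_of_mul hwp)
      refine Ideal.mem_span_singleton'.mpr ⟨C (w.coeff 0)⁻¹, ?_⟩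
      rw [← hw, ← mul_assoc]
      nth_rw 2 [eq_C_of_natDegree_eq_zero h]
      rw [C_inv_mul_C hc, one_mul]
    · have hc : p.coeff 0 ≠ 0 := h ▸ coeff_natDegree_ne_zero (right_ne_zero_of_mul hwp)
      refine (Ideal.eq_top_iff_one _).mpr (Ideal.mem_span_singleton'.mpr ⟨C (p.coeff 0)⁻¹, ?_⟩)
      nth_rw 2 [eq_C_of_natDegree_eq_zero h]
      rw [C_inv_mul_C hc]

theorem IsIrred.one_notMem_span {f : SkewPolynomial K} (hf : IsIrred f) :
    (1 : SkewPolynomial K) ∉ Ideal.span {f} :=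
  (Ideal.ne_top_iff_one _).mp hf.isMaximal_span.ne_top

theorem exists_mul_X_eq_X_mul (x : SkewPolynomial K) :
    ∃ y, X * x = y * X :=
  ⟨_, X_mul⟩

/-- The left ideal of the `w` with `w * u ∈ Rf`. -/
noncomputable def colon (f u : SkewPolynomial K) : Ideal (SkewPolynomial K) :=
  Submodule.comap (LinearMap.toSpanSingleton (SkewPolynomial K) (SkewPolynomial K) u) (Ideal.span {f})

theorem mem_colon {f u w : SkewPolynomial K} : w ∈ colon f u ↔ w * u ∈ Ideal.span {f} := Iff.rfl

/-- Since `t R ⊆ R t`, the `w` with `t w ∈ Rf` form a left ideal. It contains `Rf` and is proper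
because `t ∉ Rf`, so it equals the maximal `Rf`. Thus `t` acts injectively on `R/Rf`. -/
theorem IsIrred.mem_span_of_X_mul_mem {f : SkewPolynomial K} (hf : IsIrred f)
    (hX : X ∉ Ideal.span {f}) {w : SkewPolynomial K} (hw : X * w ∈ Ideal.span {f}) :
    w ∈ Ideal.span {f} := by
  let L : Ideal (SkewPolynomial K) :=
    { carrier := {w | X * w ∈ Ideal.span {f}}
      add_mem' := fun {a b} ha hb => by
        change X * (a + b) ∈ Ideal.span {f}
        rw [mul_add]
        exact add_mem ha hb
      zero_mem' := by
        change X * (0 : SkewPolynomial K) ∈ Ideal.span {f}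
        rw [mul_zero]
        exact zero_mem _
      smul_mem' := fun x a ha => by
        change X * (x * a) ∈ Ideal.span {f}
        obtain ⟨y, hy⟩ := exists_mul_X_eq_X_mul x
        rw [← mul_assoc, hy, mul_assoc]
        exact Ideal.mul_mem_left _ y ha }
  have h1 : L ≠ ⊤ := fun h => hX (by
    have : X * 1 ∈ Ideal.span {f} := (Ideal.eq_top_iff_one L).mp h
    rwa [mul_one] at this)
  have h2 : Ideal.span {f} ≤ L := (Ideal.span_singleton_le_iff_mem _).mpr
    (Ideal.mul_mem_left _ X (Ideal.mem_span_singleton_self f))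
  rw [hf.isMaximal_span.eq_of_le h1 h2]
  exact hw

end Ring

/-! ### Irreducibles with a common minimal central left multiple. -/

section Similar

variable {K : Type*} [Field K] [MulSemiringAction (Multiplicative ℕ) K]

/-- Pulling `t` out on the left requires preimages under `σ`; finiteness of `K` makes the injective
`φ` surjective. -/
theorem exists_eq_X_mul [Finite K] {p : SkewPolynomial K} (hp : p.coeff 0 = 0) :
    ∃ q, p = X * q := by
  have key : ∀ p : SkewPolynomial K, ∃ q, p = C (p.coeff 0) + X * q := by
    intro p
    induction p using SkewPolynomial.induction with
    | h0 => exact ⟨0, by rw [coeff_zero, C_0, mul_zero, add_zero]⟩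
    | ha m r q _ _ ih =>
      obtain ⟨s, hs⟩ := ih
      rcases m with _ | m
      · refine ⟨s, ?_⟩
        nth_rw 1 [hs]
        rw [coeff_add, monomial_zero_left, coeff_C_zero, C_add, add_assoc]
      · obtain ⟨r', rfl⟩ := (Finite.injective_iff_surjective.mp
          (φ : K →+* K).injective) r
        refine ⟨monomial m r' + s, ?_⟩
        nth_rw 1 [hs]
        rw [coeff_add, coeff_monomial_succ, zero_add, mul_add, X_mul_monomial]
        abel
  obtain ⟨q, hq⟩ := key p
  exact ⟨q, by rwa [hp, C_0, zero_add] at hq⟩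

/-- The annihilator of `R/Rf` is a two-sided ideal. A monic element `z` of least degree in it
commutes with constants and with `t`, because each relevant combination of `z` with its twists is an
annihilator of smaller degree and so vanishes. -/
theorem IsIrred.exists_central_of_annihilates [Finite K] {f : SkewPolynomial K} (hf : IsIrred f)
    (hX : X ∉ Ideal.span {f}) {b : SkewPolynomial K} (hb : b ≠ 0)
    (hann : ∀ s, b * s ∈ Ideal.span {f}) :
    ∃ z ∈ Subring.center (SkewPolynomial K), IsMonic z ∧ RightDvd f z ∧ degree z ≤ degree b := by
  classical
  have hex : ∃ m, ∃ b : SkewPolynomial K, b ≠ 0 ∧ (∀ s, b * s ∈ Ideal.span {f}) ∧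
    natDegree b = m := ⟨_, b, hb, hann, rfl⟩
  set m := Nat.find hex with hm
  obtain ⟨y, hy0, hy, hym⟩ := Nat.find_spec hex
  rw [← hm] at hym
  have hmin : ∀ a : SkewPolynomial K, (∀ s, a * s ∈ Ideal.span {f}) →
      (∀ i, m ≤ i → a.coeff i = 0) → a = 0 := by
    intro a ha hd
    by_contra h0
    exact Nat.find_min hex (natDegree_lt_of_degree_lt h0 ((degree_lt_iff a m).mpr hd))
      ⟨a, h0, ha, rfl⟩
  have hmb : m ≤ natDegree b := Nat.find_min' hex ⟨b, hb, hann, rfl⟩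
  have hlc : (y.coeff m)⁻¹ ≠ 0 := inv_ne_zero (hym ▸ coeff_natDegree_ne_zero hy0)
  obtain ⟨z, hz⟩ : ∃ z, z = C (y.coeff m)⁻¹ * y := ⟨_, rfl⟩
  have hzm : z.coeff m = 1 := by
    rw [hz, coeff_C_mul, inv_mul_cancel₀ (fun h => hlc (by rw [h, inv_zero]))]
  have hzd : natDegree z = m := by rw [hz, natDegree_C_mul hlc, hym]
  have hzgt : ∀ i, m < i → z.coeff i = 0 := fun i hi =>
    coeff_eq_zero_of_natDegree_lt (hzd ▸ hi)
  have hz0 : z ≠ 0 := by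
    rintro rfl
    rw [coeff_zero] at hzm
    exact zero_ne_one hzm
  have hza : ∀ s, z * s ∈ Ideal.span {f} := fun s => by
    rw [hz, mul_assoc]
    exact Ideal.mul_mem_left _ _ (hy s)
  -- The leading terms agree, so the difference is an annihilator of degree below `m`.
  have hcomm : ∀ c : K, z * C c = C (φ^[m] c) * z := by
    intro c
    refine sub_eq_zero.mp (hmin _ (fun s => ?_) fun i hi => ?_)
    · rw [sub_mul, mul_assoc, mul_assoc]
      exact sub_mem (hza _) (Ideal.mul_mem_left _ _ (hza _))
    · rw [coeff_sub, coeff_mul_C, coeff_C_mul]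
      rcases hi.eq_or_lt with rfl | hi
      · rw [mul_comm, sub_self]
      · rw [hzgt i hi, zero_mul, mul_zero, sub_zero]
  -- Otherwise `z = t w`, and since `t` acts injectively on `R/Rf`, the shorter `w` is already an
  -- annihilator.
  have hzc : z.coeff 0 ≠ 0 := by
    intro h
    obtain ⟨w, hw⟩ := exists_eq_X_mul h
    have hw0 : w = 0 := by
      refine hmin w (fun s => hf.mem_span_of_X_mul_mem hX ?_) fun i hi => ?_
      · rw [← mul_assoc, ← hw]
        exact hza s
      · have h1 := hzgt (i + 1) (by omega)
        rw [hw, coeff_X_mul_succ] at h1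
        exact (map_eq_zero_iff _ (φ : K →+* K).injective).mp h1
    exact hz0 (by rw [hw, hw0, mul_zero])
  -- Compare constant terms in `hcomm`, where the nonzero constant term of `z` cancels.
  have hφ : ∀ c : K, φ^[m] c = c := by
    intro c
    have h1 := congrArg (fun p => p.coeff 0) (hcomm c)
    simp only [coeff_mul_C, coeff_C_mul, Function.iterate_zero, id] at h1
    rw [mul_comm] at h1
    exact (mul_right_cancel₀ hzc h1).symm
  have hXz : X * z = z * X := by
    have hea : ∀ s, (X * z - z * X) * s ∈ Ideal.span {f} := fun s => by
      rw [sub_mul, mul_assoc, mul_assoc]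
      exact sub_mem (Ideal.mul_mem_left _ _ (hza _)) (hza _)
    -- As `z` is monic, the commutator has no `t^(m+1)` term; subtracting `e z` removes its `t^m`
    -- term too, so by minimality it equals `e z`. Its constant term is zero and that of `z` is not,
    -- whence `e = 0`.
    obtain ⟨e, he⟩ : ∃ e, e = (X * z - z * X).coeff m := ⟨_, rfl⟩
    have h1 : X * z - z * X - C e * z = 0 := by
      refine hmin _ (fun s => ?_) fun i hi => ?_
      · rw [sub_mul, mul_assoc (C e)]
        exact sub_mem (hea s) (Ideal.mul_mem_left _ _ (hza s))
      · rcases hi.eq_or_lt with rfl | hi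
        · rw [coeff_sub, coeff_C_mul, hzm, mul_one, ← he, sub_self]
        · obtain ⟨j, rfl⟩ : ∃ j, i = j + 1 := ⟨i - 1, by omega⟩
          rw [coeff_sub, coeff_sub, coeff_X_mul_succ, coeff_mul_X_succ, coeff_C_mul, hzgt _ hi]
          rcases (Nat.lt_succ_iff.mp hi).eq_or_lt with hj | hj
          · rw [← hj, hzm, map_one, sub_self, mul_zero, sub_zero]
          · rw [hzgt j hj, map_zero, sub_self, mul_zero, sub_zero]
    have h2 := congrArg (fun p => p.coeff 0) h1
    simp only [coeff_sub, coeff_X_mul_zero, coeff_mul_X_zero, coeff_C_mul, sub_self, zero_sub,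
      coeff_zero, neg_eq_zero, mul_eq_zero, or_iff_left hzc] at h2
    rw [h2, C_0, zero_mul, sub_zero] at h1
    exact sub_eq_zero.mp h1
  refine ⟨z, mem_center_of_commute hXz fun c => ?_, ?_, ?_, ?_⟩
  · rw [hcomm, hφ]
  · rw [IsMonic, hzd, hzm]
  · have h1 := hza 1
    rwa [mul_one, ← rightDvd_iff_mem_span] at h1
  · rw [degree_eq_natDegree hz0, degree_eq_natDegree hb, hzd]
    exact WithBot.coe_le_coe.mpr hmb

instance finite_degreeLT [Finite K] (d : ℕ) : Finite (degreeLT K d) := by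
  refine Finite.of_injective (fun (p : degreeLT K d) (i : Fin d) => p.1.coeff i) fun p r h => ?_
  ext i
  by_cases hi : i < d
  · exact congrFun h ⟨i, hi⟩
  · rw [(degree_lt_iff _ _).mp p.2 i (not_lt.mp hi), (degree_lt_iff _ _).mp r.2 i (not_lt.mp hi)]

/-- Multiplication on the right by `u`, followed by reduction modulo `f`. -/
noncomputable def mulRightMod (f u : SkewPolynomial K) :
    SkewPolynomial K →+ degreeLT K (natDegree f) where
  toFun b := ⟨modRight f (b * u), degree_modRight_lt f _⟩
  map_zero' := Subtype.ext ((congrArg _ (zero_mul u)).trans (modRight_zero f))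
  map_add' a b := Subtype.ext ((congrArg _ (add_mul a b u)).trans (modRight_add f _ _))

/-- Multiplication on the left by `u`, followed by reduction modulo `f`. -/
noncomputable def mulLeftMod (f u : SkewPolynomial K) :
    SkewPolynomial K →+ degreeLT K (natDegree f) where
  toFun b := ⟨modRight f (u * b), degree_modRight_lt f _⟩
  map_zero' := Subtype.ext ((congrArg _ (mul_zero u)).trans (modRight_zero f))
  map_add' a b := Subtype.ext ((congrArg _ (mul_add u a b)).trans (modRight_add f _ _))

/-- A counting argument: without such a `u`, left multiplication by `g` permutes the finite set
`R/Rf`, and the cofactor of `g` in `h` would be an annihilator of degree less than that of `h`. -/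
theorem IsIrred.exists_mul_mem_of_isMinCentralLeftMultiple [Finite K] {f g h : SkewPolynomial K}
    (hf : IsIrred f) (hg : IsIrred g) (hX : X ∉ Ideal.span {f})
    (hfh : IsMinCentralLeftMultiple f h) (hgh : RightDvd g h) :
    ∃ u, u ∉ Ideal.span {f} ∧ g * u ∈ Ideal.span {f} := by
  by_contra! hc
  have hinj : Function.Injective ((mulLeftMod f g).comp (degreeLT K (natDegree f)).subtype) := by
    rw [injective_iff_map_eq_zero]
    intro a ha
    have h1 : g * a.1 ∈ Ideal.span {f} :=
      (modRight_eq_zero_iff hf.ne_zero _).mp (congrArg Subtype.val ha)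
    have h2 : a.1 ∈ Ideal.span {f} := by
      by_contra h3
      exact hc _ h3 h1
    rw [← modRight_eq_zero_iff hf.ne_zero, modRight_of_degree_lt hf.ne_zero a.2] at h2
    exact Subtype.ext h2
  have hsurj := Finite.injective_iff_surjective.mp hinj
  obtain ⟨⟨hcen, hmon, hfh'⟩, hmin⟩ := hfh
  obtain ⟨a, rfl⟩ := hgh
  have hag : a * g ≠ 0 := by
    intro h
    rw [IsMonic, h, coeff_zero] at hmon
    exact zero_ne_one hmon
  have ha := left_ne_zero_of_mul hag
  -- Modulo `Rf` every `s` is some `g r`, and `a g r = r (a g)` because `a g` is central.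
  have hann : ∀ s, a * s ∈ Ideal.span {f} := by
    intro s
    obtain ⟨r, hr⟩ := hsurj ⟨modRight f s, degree_modRight_lt f s⟩
    have h1 : g * r.1 - s ∈ Ideal.span {f} :=
      (modRight_eq_modRight_iff hf.ne_zero).mp (congrArg Subtype.val hr)
    have h2 : a * g * r.1 ∈ Ideal.span {f} := by
      rw [← Subring.mem_center_iff.mp hcen]
      exact Ideal.mul_mem_left _ _ (rightDvd_iff_mem_span.mp hfh')
    have h3 := sub_mem h2 (Ideal.mul_mem_left _ a h1)
    rwa [mul_sub, ← mul_assoc, sub_sub_cancel] at h3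
  obtain ⟨z, hz, hz1, hz2, hz3⟩ := hf.exists_central_of_annihilates hX ha hann
  have h1 := (hmin z hz hz1 hz2).trans hz3
  rw [degree_eq_natDegree hag, degree_eq_natDegree ha, natDegree_mul ha hg.ne_zero] at h1
  have h2 : natDegree a + natDegree g ≤ natDegree a := WithBot.coe_le_coe.mp h1
  have h3 := hg.natDegree_pos
  omega

/-- The identity of skew polynomials of degree less than `d`, as a map from `𝕊_f` to `𝕊_g`. -/
noncomputable def semifieldCongr {f g : SkewPolynomial K} (h : natDegree f = natDegree g) :
    SemifieldOf f ≃+ SemifieldOf g :=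
  AddEquiv.addSubgroupCongr (h ▸ rfl : degreeLT K (natDegree f) = degreeLT K (natDegree g))

theorem SemifieldOf.ext {f : SkewPolynomial K} {a b : SemifieldOf f} (h : a.val = b.val) : a = b :=
  Subtype.ext h

theorem Isotopic.symm {S T : Type*} [NonUnitalNonAssocRing S] [NonUnitalNonAssocRing T]
    (h : Isotopic S T) : Isotopic T S := by
  obtain ⟨A, B, C, h⟩ := h
  refine ⟨A.symm, B.symm, C.symm, fun x y => ?_⟩
  rw [← C.symm_apply_apply (A.symm x * B.symm y), ← h, A.apply_symm_apply, B.apply_symm_apply]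

theorem Isotopic.trans {S T U : Type*} [NonUnitalNonAssocRing S] [NonUnitalNonAssocRing T]
    [NonUnitalNonAssocRing U] (h : Isotopic S T) (h' : Isotopic T U) : Isotopic S U := by
  obtain ⟨A, B, C, h⟩ := h
  obtain ⟨A', B', C', h'⟩ := h'
  exact ⟨A.trans A', B.trans B', C.trans C', fun x y => by
    simp only [AddEquiv.trans_apply, h', h]⟩

/-- The left ideal of all `w` with `w u ∈ Rf` is proper and contains `g`, so it equals the maximal
`Rg`. Hence right multiplication by `u` embeds `R/Rg` in `R/Rf`, and equal degrees make it
bijective. It is `R`-linear on the left, which is the isotopism identity with first component the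
identity on representatives. -/
theorem IsIrred.isotopic_of_mul_mem_span [Finite K] {f g u : SkewPolynomial K} (hf : IsIrred f)
    (hg : IsIrred g) (hd : natDegree g = natDegree f) (hu : u ∉ Ideal.span {f})
    (hgu : g * u ∈ Ideal.span {f}) : Isotopic (SemifieldOf g) (SemifieldOf f) := by
  have hcolon : Ideal.span {g} = colon f u :=
    hg.isMaximal_span.eq_of_le
      (fun h => hu (by simpa only [one_mul] using mem_colon.mp ((Ideal.eq_top_iff_one _).mp h)))
      ((Ideal.span_singleton_le_iff_mem _).mpr (mem_colon.mpr hgu))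
  let T : SemifieldOf g →+ SemifieldOf f :=
    (mulRightMod f u).comp (degreeLT K (natDegree g)).subtype
  have hinj : Function.Injective T := by
    rw [injective_iff_map_eq_zero]
    intro a ha
    have h1 : a.val * u ∈ Ideal.span {f} :=
      (modRight_eq_zero_iff hf.ne_zero _).mp (congrArg SemifieldOf.val ha)
    have h2 : a.val ∈ Ideal.span {g} := by
      rw [hcolon]
      exact mem_colon.mpr h1
    rw [← modRight_eq_zero_iff hg.ne_zero] at h2
    exact SemifieldOf.ext ((modRight_of_degree_lt hg.ne_zero a.2).symm.trans h2)
  let e := semifieldCongr hd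
  have : Finite (SemifieldOf g) := finite_degreeLT (natDegree g)
  have hsurj : Function.Surjective T := by
    have h1 : Function.Surjective (e.symm ∘ T) :=
      Finite.injective_iff_surjective.mp (e.symm.injective.comp hinj)
    intro y
    obtain ⟨x, hx⟩ := h1 (e.symm y)
    exact ⟨x, e.symm.injective hx⟩
  refine ⟨e, AddEquiv.ofBijective T ⟨hinj, hsurj⟩, AddEquiv.ofBijective T ⟨hinj, hsurj⟩,
    fun x y => SemifieldOf.ext ?_⟩
  change modRight f (x.val * modRight f (y.val * u)) =
    modRight f (modRight g (x.val * y.val) * u)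
  have h1 : modRight f (x.val * modRight f (y.val * u)) = modRight f (x.val * (y.val * u)) := by
    rw [eq_comm, modRight_eq_modRight_iff hf.ne_zero, ← mul_sub]
    exact Ideal.mul_mem_left _ _ (sub_modRight_mem_span hf.ne_zero _)
  rw [h1, modRight_eq_modRight_iff hf.ne_zero, ← mul_assoc, ← sub_mul, ← mem_colon, ← hcolon]
  exact sub_modRight_mem_span hg.ne_zero _

/-- An irreducible right divisor of `t` has degree one and is a scalar multiple of `t`. This covers
the case where `t` does not act injectively. -/
theorem IsIrred.mem_span_of_X_mem_span {f g : SkewPolynomial K} (hg : IsIrred g)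
    (hf : X ∈ Ideal.span {f}) (hgX : X ∈ Ideal.span {g}) : g ∈ Ideal.span {f} := by
  obtain ⟨v, hv⟩ := Ideal.mem_span_singleton'.mp hgX
  have hX : natDegree (X : SkewPolynomial K) ≤ 1 := by
    by_contra hc
    exact coeff_natDegree_ne_zero X_ne_zero (coeff_X_of_ne_one (by omega))
  have hv0 : v ≠ 0 := left_ne_zero_of_mul (hv ▸ X_ne_zero)
  rw [← hv, natDegree_mul hv0 hg.ne_zero] at hX
  have hpos := hg.natDegree_pos
  have h0 : natDegree v = 0 := by omega
  have hc : v.coeff 0 ≠ 0 := h0 ▸ coeff_natDegree_ne_zero hv0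
  have h1 : g = C (v.coeff 0)⁻¹ * X := by
    rw [← hv, ← mul_assoc]
    nth_rw 2 [eq_C_of_natDegree_eq_zero h0]
    rw [C_inv_mul_C hc, one_mul]
  rw [h1]
  exact Ideal.mul_mem_left _ _ hf

theorem IsIrred.isotopic_of_isMinCentralLeftMultiple [Finite K] {f g h : SkewPolynomial K}
    (hf : IsIrred f) (hg : IsIrred g) (hd : natDegree f = natDegree g)
    (hfh : IsMinCentralLeftMultiple f h) (hgh : IsMinCentralLeftMultiple g h) :
    Isotopic (SemifieldOf f) (SemifieldOf g) := by
  by_cases hfX : X ∈ Ideal.span {f}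
  · by_cases hgX : X ∈ Ideal.span {g}
    -- Both are scalar multiples of `t`, so `u = 1` serves.
    · refine hg.isotopic_of_mul_mem_span hf hd hg.one_notMem_span ?_
      rw [mul_one]
      exact hf.mem_span_of_X_mem_span hgX hfX
    · obtain ⟨u, hu, hfu⟩ :=
        hg.exists_mul_mem_of_isMinCentralLeftMultiple hf hgX hgh hfh.1.2.2
      exact hg.isotopic_of_mul_mem_span hf hd hu hfu
  · obtain ⟨u, hu, hgu⟩ := hf.exists_mul_mem_of_isMinCentralLeftMultiple hg hfX hfh hgh.1.2.2
    exact (hf.isotopic_of_mul_mem_span hg hd.symm hu hgu).symm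

end Similar

/-! ### Norms and automorphisms of finite fields. -/

section FiniteField

variable {K : Type*} [Field K] [Finite K]

/-- By Galois theory `σ` generates the Galois group over its fixed field, and its order is the
degree `n`. The product is therefore the norm, which is surjective for finite fields. -/
theorem exists_prod_iterate_eq (σ : K ≃+* K) {n : ℕ}
    (hn : Nat.card K = Nat.card (fixedField σ) ^ n) (x : fixedField σ) :
    ∃ c : K, ∏ i ∈ Finset.range n, σ^[i] c = x := by
  let F := fixedField σ
  have hfin : n = Module.finrank F K :=
    Nat.pow_right_injective Finite.one_lt_card
      (hn.symm.trans (Module.natCard_eq_pow_finrank (K := F)))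
  let s : Gal(K/F) := AlgEquiv.ofRingEquiv (f := σ) fun y => y.2
  have htop : Subgroup.zpowers s = ⊤ := by
    have hbot : IntermediateField.fixedField (Subgroup.zpowers s) = ⊥ := by
      rw [eq_bot_iff]
      intro y hy
      have h1 : s y = y := hy ⟨s, Subgroup.mem_zpowers s⟩
      exact IntermediateField.mem_bot.mpr ⟨⟨y, h1⟩, rfl⟩
    rw [← IntermediateField.fixingSubgroup_fixedField (Subgroup.zpowers s), hbot,
      IntermediateField.fixingSubgroup_bot]
  have hord : orderOf s = n := by
    rw [← Nat.card_zpowers, htop, Subgroup.card_top, IsGalois.card_aut_eq_finrank, hfin]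
  obtain ⟨c, hc⟩ := FiniteField.norm_surjective F K x
  refine ⟨c, ?_⟩
  classical
  have h1 := Algebra.norm_eq_prod_automorphisms F c
  rw [hc, ← IsCyclic.image_range_orderOf (a := s) fun y => htop ▸ Subgroup.mem_top y,
    Finset.prod_image (fun i hi j hj h => pow_injOn_Iio_orderOf
      (Finset.mem_range.mp hi) (Finset.mem_range.mp hj) h), hord] at h1
  refine Eq.trans (Finset.prod_congr rfl fun i _ => ?_) h1.symm
  rw [AlgEquiv.coe_pow]
  rfl

/-- An automorphism of a finite field is a power of Frobenius. As a power map it extends to `K`. -/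
theorem exists_pow_eq_ringEquiv (p : ℕ) [Fact p.Prime] [CharP K p] (F : Subfield K)
    (ρ : F ≃+* F) : ∃ j : ℕ, ∀ x : F, (ρ x : K) = (x : K) ^ p ^ j := by
  have : CharP F p := inferInstance
  let _ : Algebra (ZMod p) F := ZMod.algebra F p
  let s : Gal(F/ZMod p) := AlgEquiv.ofRingEquiv (f := ρ) fun y =>
    DFunLike.congr_fun (Subsingleton.elim ((ρ : F →+* F).comp (algebraMap (ZMod p) F))
      (algebraMap (ZMod p) F)) y
  obtain ⟨j, hj⟩ := (FiniteField.bijective_frobeniusAlgEquivOfAlgebraic_pow (ZMod p) F).2 s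
  refine ⟨j, fun x => ?_⟩
  have h1 : s x = x ^ p ^ (j : ℕ) := by
    rw [← hj]
    change (FiniteField.frobeniusAlgEquivOfAlgebraic (ZMod p) F ^ (j : ℕ)) x = _
    rw [AlgEquiv.coe_pow, FiniteField.coe_frobeniusAlgEquivOfAlgebraic_iterate, ZMod.card]
  exact congrArg Subtype.val h1

end FiniteField

/-! ### The automorphisms `a t^i ↦ τ(a) (c t)^i`. -/

section Automorphism

variable {K : Type*} [Field K] [MulSemiringAction (Multiplicative ℕ) K]

theorem C_mul_X_pow (c : K) (n : ℕ) :
    (C c * X : SkewPolynomial K) ^ n = monomial n (∏ i ∈ Finset.range n, φ^[i] c) := by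
  induction n with
  | zero => rw [pow_zero, Finset.range_zero, Finset.prod_empty, monomial_zero_one]
  | succ n ih =>
    rw [pow_succ, ih, C_mul_X_eq_monomial, monomial_mul_monomial, Finset.prod_range_succ]

/-- The ring endomorphism of `K[t; σ]` sending `a * t ^ i` to `τ(a) * (c * t) ^ i`, for an
automorphism `τ` commuting with `σ`. -/
noncomputable def substHom (τ : K ≃+* K) (hτ : ∀ (m : Multiplicative ℕ) (x : K), τ (m • x) = m • τ x)
    (c : K) : SkewPolynomial K →+* SkewPolynomial K :=
  SkewMonoidAlgebra.liftNCRingHom (CRingHom.comp (τ : K →+* K))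
    (powersHom (SkewPolynomial K) (C c * X)) fun {x y} => by
      rw [powersHom_apply, C_mul_X_pow]
      -- The relation `t^i x = σ^i(x) t^i` is preserved because `τ` commutes with the action and `K`
      -- is commutative.
      change C (τ (y • x)) * _ = _ * C (τ x)
      rw [C_mul_monomial, monomial_mul_C, φ_iterate_apply _ (τ x), ofAdd_toAdd, hτ, mul_comm]

variable (τ : K ≃+* K) (hτ : ∀ (m : Multiplicative ℕ) (x : K), τ (m • x) = m • τ x) (c : K)

theorem substHom_monomial (i : ℕ) (a : K) :
    substHom τ hτ c (monomial i a) = monomial i (τ a * ∏ j ∈ Finset.range i, φ^[j] c) := by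
  refine (SkewMonoidAlgebra.liftNC_single _ _ _ _).trans ?_
  change C (τ a) * powersHom (SkewPolynomial K) (C c * X) (Multiplicative.ofAdd i) = _
  rw [powersHom_apply, toAdd_ofAdd, C_mul_X_pow, C_mul_monomial]

theorem coeff_substHom (p : SkewPolynomial K) (i : ℕ) :
    (substHom τ hτ c p).coeff i = τ (p.coeff i) * ∏ j ∈ Finset.range i, φ^[j] c := by
  induction p using SkewPolynomial.induction with
  | h0 => rw [map_zero, coeff_zero, map_zero, zero_mul]
  | ha m r q _ _ ih =>
    rw [map_add, coeff_add, ih, substHom_monomial, coeff_add, map_add, add_mul, coeff_monomial,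
      coeff_monomial]
    split_ifs with h
    · rw [h]
    · rw [map_zero, zero_mul]

theorem prod_iterate_φ_ne_zero {c : K} (hc : c ≠ 0) (i : ℕ) :
    ∏ j ∈ Finset.range i, φ^[j] c ≠ 0 :=
  Finset.prod_ne_zero_iff.mpr fun j _ => iterate_φ_ne_zero hc j

theorem coeff_substHom_eq_zero_iff {c : K} (hc : c ≠ 0) (p : SkewPolynomial K) (i : ℕ) :
    (substHom τ hτ c p).coeff i = 0 ↔ p.coeff i = 0 := by
  rw [coeff_substHom, mul_eq_zero, or_iff_left (prod_iterate_φ_ne_zero hc i), map_eq_zero_iff]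
  exact τ.injective

theorem substHom_bijective {c : K} (hc : c ≠ 0) : Function.Bijective (substHom τ hτ c) := by
  constructor
  · rw [injective_iff_map_eq_zero]
    intro p hp
    ext i
    rw [coeff_zero, ← coeff_substHom_eq_zero_iff τ hτ hc, hp, coeff_zero]
  · intro p
    induction p using SkewPolynomial.induction with
    | h0 => exact ⟨0, map_zero _⟩
    | ha m r q _ _ ih =>
      obtain ⟨s, rfl⟩ := ih
      refine ⟨monomial m (τ.symm (r / ∏ j ∈ Finset.range m, φ^[j] c)) + s, ?_⟩
      rw [map_add, substHom_monomial, τ.apply_symm_apply,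
        div_mul_cancel₀ _ (prod_iterate_φ_ne_zero hc m)]

/-- `substHom` as an automorphism, for `c ≠ 0`. -/
noncomputable def substEquiv {c : K} (hc : c ≠ 0) : SkewPolynomial K ≃+* SkewPolynomial K :=
  RingEquiv.ofBijective (substHom τ hτ c) (substHom_bijective τ hτ hc)

theorem degree_substEquiv {c : K} (hc : c ≠ 0) (p : SkewPolynomial K) :
    degree (substEquiv τ hτ hc p) = degree p :=
  degree_congr fun i => coeff_substHom_eq_zero_iff τ hτ hc p i

/-- By additivity it suffices to treat `a y^k`. There `t^n` goes to `μ t^n`, the norm of `c` being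
`μ`, and `μ` commutes with `t^n` because `σ` fixes it. -/
theorem evalXPow_twist {σ : K ≃+* K} (hσ : ∀ a : K, φ a = σ a) {n d : ℕ} {c : K} {μ : (fixedField σ)ˣ}
    {ρ : fixedField σ ≃+* fixedField σ} (hρ : ∀ x, ((ρ x : fixedField σ) : K) = τ x)
    (hμ : ∏ j ∈ Finset.range n, φ^[j] c = (μ : fixedField σ)) (p : Polynomial (fixedField σ)) :
    evalXPow σ n (twist d μ ρ p) =
      C (((μ : fixedField σ) : K)⁻¹ ^ d) * substHom τ hτ c (evalXPow σ n p) := by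
  have hadd : ∀ p r : Polynomial (fixedField σ),
      evalXPow σ n (p + r) = evalXPow σ n p + evalXPow σ n r := fun p r =>
    Polynomial.eval₂_add _ _
  induction p using Polynomial.induction_on' with
  | add p r hp hr =>
    rw [hadd, map_add, mul_add, ← hp, ← hr, ← hadd, twist, twist, twist, Polynomial.map_add,
      Polynomial.add_comp, mul_add]
  | monomial k a =>
    have h1 : twist d μ ρ (Polynomial.monomial k a) =
        Polynomial.monomial k ((μ : fixedField σ)⁻¹ ^ d * (ρ a * (μ : fixedField σ) ^ k)) := by
      rw [twist, Polynomial.map_monomial, Polynomial.monomial_comp, mul_pow, ← Polynomial.C_pow,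
        ← mul_assoc (Polynomial.C _), ← Polynomial.C_mul, ← mul_assoc, ← Polynomial.C_mul,
        Polynomial.C_mul_X_pow_eq_monomial, mul_assoc]
      rfl
    have h2 : ∀ (b : fixedField σ),
        evalXPow σ n (Polynomial.monomial k b) = C (b : K) * (X ^ n) ^ k := fun b =>
      Polynomial.eval₂_monomial _ _
    have h3 : substHom τ hτ c (C (a : K)) = C (τ a) := by
      rw [← monomial_zero_left, substHom_monomial, Finset.range_zero, Finset.prod_empty, mul_one,
        monomial_zero_left]
    have h4 : substHom τ hτ c (X ^ n) = C ((μ : fixedField σ) : K) * X ^ n := by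
      rw [← monomial_one_right_eq_X_pow, substHom_monomial, hμ, map_one, one_mul,
        C_mul_monomial, mul_one]
    have h5 : Commute (C ((μ : fixedField σ) : K)) (X ^ n : SkewPolynomial K) := by
      have h : φ ((μ : fixedField σ) : K) = ((μ : fixedField σ) : K) :=
        (hσ _).trans (μ : fixedField σ).2
      rw [← monomial_one_right_eq_X_pow, commute_iff_eq, C_mul_monomial, monomial_mul_C,
        Function.iterate_fixed h, mul_one, one_mul]
    rw [h1, h2, h2, map_mul (substHom τ hτ c), h3, map_pow (substHom τ hτ c), h4, h5.mul_pow,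
      ← C_pow, ← mul_assoc (C (τ a)), ← C_mul,
      ← mul_assoc (C (((μ : fixedField σ) : K)⁻¹ ^ d)), ← C_mul, ← hρ]
    rfl

end Automorphism

/-! ### Transport along degree-preserving automorphisms. -/

section Transport

variable {K : Type*} [Field K] [MulSemiringAction (Multiplicative ℕ) K]

theorem natDegree_map {e : SkewPolynomial K ≃+* SkewPolynomial K}
    (he : ∀ p, degree (e p) = degree p) (p : SkewPolynomial K) :
    natDegree (e p) = natDegree p := by
  rw [natDegree, natDegree, he]

theorem IsIrred.map {e : SkewPolynomial K ≃+* SkewPolynomial K}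
    (he : ∀ p, degree (e p) = degree p) {f : SkewPolynomial K} (hf : IsIrred f) :
    IsIrred (e f) := by
  refine ⟨(he f).symm ▸ hf.1, fun ⟨a, b, ha, hb, hab⟩ => hf.2 ⟨e.symm a, e.symm b, ?_, ?_, ?_⟩⟩
  · rwa [← he, e.apply_symm_apply, ← he f]
  · rwa [← he, e.apply_symm_apply, ← he f]
  · rw [← map_mul, ← hab, e.symm_apply_apply]

theorem isotopic_map {e : SkewPolynomial K ≃+* SkewPolynomial K}
    (he : ∀ p, degree (e p) = degree p) {f : SkewPolynomial K} (hf : f ≠ 0) :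
    Isotopic (SemifieldOf f) (SemifieldOf (e f)) := by
  have hlt : ∀ {p : SkewPolynomial K}, degree p < natDegree f → degree (e p) < natDegree (e f) :=
    fun {p} hp => by rwa [he, natDegree_map he]
  let E : SemifieldOf f ≃+ SemifieldOf (e f) :=
    { toFun := fun a => ⟨e a.val, hlt a.2⟩
      invFun := fun a => ⟨e.symm a.val, by
        change degree (e.symm a.val) < natDegree f
        rw [← he, e.apply_symm_apply, ← natDegree_map he f]
        exact a.2⟩
      left_inv := fun a => SemifieldOf.ext (e.symm_apply_apply a.val)
      right_inv := fun a => SemifieldOf.ext (e.apply_symm_apply a.val)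
      map_add' := fun a b => SemifieldOf.ext (map_add e a.val b.val) }
  refine ⟨E, E, E, fun x y => SemifieldOf.ext ?_⟩
  change modRight (e f) (e x.val * e y.val) = e (modRight f (x.val * y.val))
  obtain ⟨u, hu⟩ := exists_eq_mul_add_modRight hf (x.val * y.val)
  refine modRight_eq (u := e u) ((map_ne_zero_iff e e.injective).mpr hf)
    (hlt (degree_modRight_lt _ _)) ?_
  rw [← map_mul, ← map_mul, ← map_add, ← hu]

/-- Comparing leading coefficients in `t z = z t` shows that the leading coefficient is fixed by
`σ`. Central elements can therefore be made monic without leaving the centre. -/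
theorem C_inv_leadingCoeff_mem_center {z : SkewPolynomial K}
    (hz : z ∈ Subring.center (SkewPolynomial K)) :
    C (z.coeff (natDegree z))⁻¹ ∈ Subring.center (SkewPolynomial K) := by
  have h1 : φ (z.coeff (natDegree z)) = z.coeff (natDegree z) := by
    rw [← coeff_X_mul_succ, Subring.mem_center_iff.mp hz, coeff_mul_X_succ]
  refine mem_center_of_commute ?_ fun c => ?_
  · rw [← monomial_one_one_eq_X, C_mul_monomial, monomial_mul_C, Function.iterate_one, map_inv₀,
      h1, mul_one, one_mul]
  · rw [← C_mul, ← C_mul, mul_comm]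

theorem IsMinCentralLeftMultiple.le_degree {f h z : SkewPolynomial K}
    (hfh : IsMinCentralLeftMultiple f h) (hz : z ∈ Subring.center (SkewPolynomial K))
    (hz0 : z ≠ 0) (hfz : RightDvd f z) : degree h ≤ degree z := by
  have hc : (z.coeff (natDegree z))⁻¹ ≠ 0 := inv_ne_zero (coeff_natDegree_ne_zero hz0)
  rw [← degree_C_mul hc z]
  refine hfh.2 _ (mul_mem (C_inv_leadingCoeff_mem_center hz) hz) ?_ ?_
  · rw [IsMonic, natDegree_C_mul hc, coeff_C_mul, inv_mul_cancel₀ (coeff_natDegree_ne_zero hz0)]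
  · rw [rightDvd_iff_mem_span] at hfz ⊢
    exact Ideal.mul_mem_left _ _ hfz

theorem IsMinCentralLeftMultiple.map {e : SkewPolynomial K ≃+* SkewPolynomial K}
    (he : ∀ p, degree (e p) = degree p) {f h : SkewPolynomial K}
    (hfh : IsMinCentralLeftMultiple f h) {k : K} (hk : k ≠ 0)
    (hcen : C k * e h ∈ Subring.center (SkewPolynomial K)) (hmon : IsMonic (C k * e h)) :
    IsMinCentralLeftMultiple (e f) (C k * e h) := by
  refine ⟨⟨hcen, hmon, ?_⟩, fun z hz hz1 ⟨u, hu⟩ => ?_⟩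
  · obtain ⟨u, hu⟩ := hfh.1.2.2
    exact ⟨C k * e u, by rw [hu, map_mul, mul_assoc]⟩
  · rw [degree_C_mul hk, he, ← e.apply_symm_apply z, he]
    -- The preimage of `z` need not be monic, hence the use of the version of minimality for all
    -- nonzero central multiples.
    refine hfh.le_degree ?_ ?_ ⟨e.symm u, ?_⟩
    · rw [Subring.mem_center_iff]
      intro p
      apply e.injective
      rw [map_mul, map_mul, e.apply_symm_apply, Subring.mem_center_iff.mp hz]
    · intro h0
      rw [(map_eq_zero_iff e.symm e.symm.injective).mp h0, IsMonic, coeff_zero] at hz1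
      exact zero_ne_one hz1
    · rw [hu, map_mul, e.symm_apply_apply]

end Transport

end SkewSemifield

theorem mainTheorem3 {K : Type*} [Field K] [Finite K] [MulSemiringAction (Multiplicative ℕ) K]
    (σ : K ≃+* K) (hσ : ∀ a : K, Multiplicative.ofAdd (1 : ℕ) • a = σ a)
    (q n : ℕ) (hq : Nat.card (SkewSemifield.fixedField σ) = q) (hn : Nat.card K = q ^ n)
    (d : ℕ) (f g : SkewPolynomial K)
    (hf : SkewSemifield.IsIrred f) (hfd : SkewSemifield.degree f = d)
    (hg : SkewSemifield.IsIrred g) (hgd : SkewSemifield.degree g = d)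
    (f' g' : Polynomial (SkewSemifield.fixedField σ))
    (hf' : SkewSemifield.IsMinCentralLeftMultiple f (SkewSemifield.evalXPow σ n f'))
    (hg' : SkewSemifield.IsMinCentralLeftMultiple g (SkewSemifield.evalXPow σ n g'))
    (μ : (SkewSemifield.fixedField σ)ˣ)
    (ρ : SkewSemifield.fixedField σ ≃+* SkewSemifield.fixedField σ)
    (hfg : g' = SkewSemifield.twist d μ ρ f') :
    SkewSemifield.Isotopic (SkewSemifield.SemifieldOf f) (SkewSemifield.SemifieldOf g) := by
  obtain ⟨p, hchar⟩ := CharP.exists K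
  have : Fact p.Prime := ⟨CharP.char_is_prime K p⟩
  have hφ : ∀ a : K, SkewPolynomial.φ a = σ a := hσ
  obtain ⟨c, hc⟩ := SkewSemifield.exists_prod_iterate_eq σ (by rw [hn, hq]) μ
  obtain ⟨j, hj⟩ := SkewSemifield.exists_pow_eq_ringEquiv p (SkewSemifield.fixedField σ) ρ
  let τ : K ≃+* K := iterateFrobeniusEquiv K p j
  -- A Frobenius power commutes with every ring endomorphism, in particular with `σ`.
  have hτ : ∀ (m : Multiplicative ℕ) (x : K), τ (m • x) = m • τ x := fun m x =>
    (smul_pow' m x (p ^ j)).symm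
  have hμ0 : ((μ : SkewSemifield.fixedField σ) : K) ≠ 0 := by
    exact_mod_cast μ.ne_zero
  have hσφ : (⇑(SkewPolynomial.φ : K →+* K)) = σ := funext hφ
  have hc' : ∏ i ∈ Finset.range n, SkewPolynomial.φ^[i] c = (μ : SkewSemifield.fixedField σ) := by
    rw [hσφ, hc]
  -- For `n = 0` the norm product would be empty and would not force `c ≠ 0`.
  have hn0 : 0 < n := by
    rcases Nat.eq_zero_or_pos n with rfl | h
    · have := Finite.one_lt_card (α := K)
      rw [hn, pow_zero] at this
      exact absurd this (lt_irrefl 1)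
    · exact h
  have hc0 : c ≠ 0 := by
    rintro rfl
    refine hμ0 (hc'.symm.trans (Finset.prod_eq_zero (Finset.mem_range.mpr hn0) ?_))
    rfl
  let e := SkewSemifield.substEquiv τ hτ hc0
  have he : ∀ p, SkewSemifield.degree (e p) = SkewSemifield.degree p :=
    SkewSemifield.degree_substEquiv τ hτ hc0
  have htwist : SkewSemifield.evalXPow σ n g' =
      SkewPolynomial.C (((μ : SkewSemifield.fixedField σ) : K)⁻¹ ^ d) *
        e (SkewSemifield.evalXPow σ n f') := by
    rw [hfg]
    exact SkewSemifield.evalXPow_twist τ hτ hφ hj hc' f'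
  have hk : ((μ : SkewSemifield.fixedField σ) : K)⁻¹ ^ d ≠ 0 := pow_ne_zero _ (inv_ne_zero hμ0)
  -- Centrality and monicity of the transported multiple come from its being `ĝ(t^n)`, for which
  -- `hg'` supplies both.
  have hef := SkewSemifield.IsMinCentralLeftMultiple.map he hf' hk (htwist ▸ hg'.1.1)
    (htwist ▸ hg'.1.2.1)
  rw [← htwist] at hef
  refine (SkewSemifield.isotopic_map he hf.ne_zero).trans
    ((hf.map he).isotopic_of_isMinCentralLeftMultiple hg ?_ hef hg')
  rw [SkewSemifield.natDegree_map he, SkewSemifield.natDegree_eq_of_degree_eq hfd,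
    SkewSemifield.natDegree_eq_of_degree_eq hgd]
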